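/- For $k\in\mathbb Z$ and $x\in\mathbb R$ let $I_k(x)=\frac1\pi\int_0^\pi e^{x\cos\theta}\cos(k\theta)\,d\theta$ be the modified Bessel function. For every mesh size $h>0$ let $v^h=(v^h_k(t))_{k\in\mathbb Z,\,t\ge 0}$ be a complex-valued solution of the discrete heat equation $$\partial_t v_k^h(t)=\frac{v_{k+1}^h(t)-2v_k^h(t)+v_{k-1}^h(t)}{h^2},\qquad k\in\mathbb Z,\ t\ge 0,$$ that is bounded on $[0,T]\times\mathbb Z$ for every $T>0$ (with bound allowed to depend on $h$ and $T$). Suppose that there are $s>1/2$, a function $u_0\in H^s(\mathbb R)$ (complex-valued, identified with its continuous representative) and $\mu>0$ such that, for all $h>0$, $$\sup_{k\in\mathbb Z}|v_k^h(0)-u_0(kh)|<h^\mu .$$ Suppose also that there are $\alpha<2$ and a constant $C$, independent of $h$ and $k$, such that, for all $k\in\mathbb Z$ and all $h>0$, $$|v_k^h(1)|\le C\,\frac{I_k(\alpha/h^2)}{I_0(\alpha/h^2)} .$$ Then $u_0\equiv 0$, and $v_k^h(t)\to 0$ as $h\to 0^+$, uniformly in $k\in\mathbb Z$ and $t\ge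 0$. -/

import Mathlib

open Set Filter Topology MeasureTheory
open scoped ENNReal SchwartzMap

noncomputable section

/-- The modified Bessel function of integer order `k` at a real argument,
`I_k(x) = (1/π) ∫₀^π exp(x cos θ) cos(kθ) dθ`. -/
def besselI (k : ℤ) (x : ℝ) : ℝ :=
  (1 / Real.pi) * ∫ θ in (0 : ℝ)..Real.pi, Real.exp (x * Real.cos θ) * Real.cos (k * θ)

/-- `v t k` (time `t ≥ 0`, lattice index `k`) is a solution of the discrete heat equation
`∂ₜ v_k = (v_{k+1} - 2 v_k + v_{k-1}) / h²` on the lattice `hℤ`, in the class of functions that are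
bounded on `[0, T] × ℤ` for each `T`. For bounded initial data this is the class in which the
solution is unique and given by the discrete heat semigroup. At `t = 0` the time derivative is
one-sided; at `t > 0` it is the usual one. -/
structure IsDiscreteHeatSolution (h : ℝ) (v : ℝ → ℤ → ℂ) : Prop where
  bounded : ∀ T : ℝ, ∃ M : ℝ, ∀ t ∈ Icc 0 T, ∀ k : ℤ, ‖v t k‖ ≤ M
  heat : ∀ t : ℝ, 0 ≤ t → ∀ k : ℤ,
    HasDerivWithinAt (fun τ : ℝ => v τ k)
      ((v t (k + 1) - 2 * v t k + v t (k - 1)) / (h : ℂ) ^ 2) (Ici 0) t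

/-- `u` is the continuous representative of an element of the `L²`-based Sobolev space `H^s(ℝ)`
(used for `s > 1/2`, where every element has one): `u` is continuous and square integrable, and
the tempered distribution it defines lies in `H^s`. -/
def IsContinuousSobolev (s : ℝ) (u : ℝ → ℂ) : Prop :=
  Continuous u ∧ ∃ hu : MemLp u 2 (volume : Measure ℝ),
    TemperedDistribution.MemSobolev s 2 ((hu.toLp u : Lp ℂ 2 (volume : Measure ℝ)) : 𝓢'(ℝ, ℂ))

end

/-! Since `s > 1/2`, `u₀` is the inverse Fourier transform of an integrable `g`. The discrete flow
started from `u₀` is the explicit integral `latticeWave`, and by the maximum principle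
(`IsDiscreteHeatSolution.norm_le`) it stays within `h ^ μ` of `v h`. As `h → 0`, at time one it
converges pointwise to the heat evolution `heatExtension g` of `u₀`.

A contour shift bounds the Bessel ratio by `exp (-k l + (a / h²) (cosh l - 1))` for every real `l`,
where `a` is `α` replaced by a positive number still below 2. With `k h = x` and `l = x h / a`, the
limit is `‖heatExtension g x‖ ≤ C exp (-x² / (2 a))`, and `1 / (2 a) > 1 / 4`.

On the other hand, `heatExtension g` is entire and bounded by a constant times `exp ((Im z)² / 4)`.
Decay on the real axis faster than this growth allows is impossible for a nonzero function: this is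
Hardy's uncertainty principle (`eq_zero_of_gaussian_bounds`), proved by Phragmén–Lindelöf and
Liouville. Hence `g = 0` almost everywhere and `u₀ = 0`; the maximum principle then gives `‖v h t k‖
≤ h ^ μ`. -/

open scoped FourierTransform

/-! ### Maximum principle for the discrete heat equation -/

namespace IsDiscreteHeatSolution

theorem sub {h : ℝ} {v w : ℝ → ℤ → ℂ} (hv : IsDiscreteHeatSolution h v)
    (hw : IsDiscreteHeatSolution h w) : IsDiscreteHeatSolution h (fun t k => v t k - w t k) where
  bounded T := by
    obtain ⟨M, hM⟩ := hv.bounded T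
    obtain ⟨N, hN⟩ := hw.bounded T
    exact ⟨M + N, fun t ht k => (norm_sub_le _ _).trans (add_le_add (hM t ht k) (hN t ht k))⟩
  heat t ht k := by
    exact ((hv.heat t ht k).sub (hw.heat t ht k)).congr_deriv (by ring)

/-- The integrating factor `exp (2 t / h²)` removes the diagonal term of the discrete Laplacian. -/
theorem hasDerivWithinAt_exp_mul {h : ℝ} {v : ℝ → ℤ → ℂ} (hv : IsDiscreteHeatSolution h v)
    {t : ℝ} (ht : 0 ≤ t) (k : ℤ) :
    HasDerivWithinAt (fun τ : ℝ => (Real.exp (2 / h ^ 2 * τ) : ℂ) * v τ k)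
      ((1 / h ^ 2 : ℝ) * ((Real.exp (2 / h ^ 2 * t) : ℂ) * v t (k + 1) +
        (Real.exp (2 / h ^ 2 * t) : ℂ) * v t (k - 1))) (Ici 0) t := by
  have h1 : HasDerivAt (fun τ : ℝ => Real.exp (2 / h ^ 2 * τ))
      (Real.exp (2 / h ^ 2 * t) * (2 / h ^ 2)) t := by
    simpa using ((hasDerivAt_id t).const_mul (2 / h ^ 2)).exp
  refine (h1.ofReal_comp.hasDerivWithinAt.mul (hv.heat t ht k)).congr_deriv ?_
  push_cast
  ring

/-- Picard iteration: the bound for `n`, applied at both neighbours, bounds the derivative, and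
integrating gives the bound for `n + 1`. The a priori bound `M` enters only at `n = 0`; its
contribution becomes a Taylor term that vanishes as `n → ∞`. -/
theorem norm_exp_mul_le {h : ℝ} {v : ℝ → ℤ → ℂ} (hv : IsDiscreteHeatSolution h v)
    {M₀ M T : ℝ} (h0 : ∀ k, ‖v 0 k‖ ≤ M₀) (hM : ∀ t ∈ Icc 0 T, ∀ k, ‖v t k‖ ≤ M) (n : ℕ) :
    ∀ t ∈ Icc 0 T, ∀ k, ‖(Real.exp (2 / h ^ 2 * t) : ℂ) * v t k‖ ≤
      M₀ * Real.exp (2 / h ^ 2 * t) +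
        Real.exp (2 / h ^ 2 * T) * M * ((2 / h ^ 2 * t) ^ n / n.factorial) := by
  have hM₀ : 0 ≤ M₀ := (norm_nonneg _).trans (h0 0)
  have ha : 0 ≤ 2 / h ^ 2 := by positivity
  induction n with
  | zero =>
    intro t ht k
    have hMt := hM t ht k
    have : Real.exp (2 / h ^ 2 * t) ≤ Real.exp (2 / h ^ 2 * T) := by
      have := ht.2
      gcongr
    rw [norm_mul, Complex.norm_real, Real.norm_of_nonneg (Real.exp_pos _).le]
    have : Real.exp (2 / h ^ 2 * t) * ‖v t k‖ ≤ Real.exp (2 / h ^ 2 * T) * M := by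
      gcongr
    simp only [pow_zero, Nat.factorial_zero, Nat.cast_one, div_one, mul_one]
    have := mul_nonneg hM₀ (Real.exp_pos (2 / h ^ 2 * t)).le
    linarith
  | succ n ih =>
    intro t ht k
    have hcont : ContinuousOn (fun τ : ℝ => (Real.exp (2 / h ^ 2 * τ) : ℂ) * v τ k) (Icc 0 T) :=
      fun τ hτ => (hv.hasDerivWithinAt_exp_mul hτ.1 k).continuousWithinAt.mono
        Icc_subset_Ici_self
    refine image_norm_le_of_norm_deriv_right_le_deriv_boundary (a := 0) (b := T)
      (f := fun τ : ℝ => (Real.exp (2 / h ^ 2 * τ) : ℂ) * v τ k)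
      (B := fun t => M₀ * Real.exp (2 / h ^ 2 * t) + Real.exp (2 / h ^ 2 * T) * M *
        ((2 / h ^ 2 * t) ^ (n + 1) / (n + 1).factorial))
      (B' := fun t => 2 / h ^ 2 * (M₀ * Real.exp (2 / h ^ 2 * t) +
        Real.exp (2 / h ^ 2 * T) * M * ((2 / h ^ 2 * t) ^ n / n.factorial)))
      hcont (fun τ hτ => (hv.hasDerivWithinAt_exp_mul hτ.1 k).mono (Ici_subset_Ici.2 hτ.1))
      ?_ ?_ ?_ ht
    · simpa using h0 k
    · intro x
      have h1 : HasDerivAt (fun τ : ℝ => 2 / h ^ 2 * τ) (2 / h ^ 2) x := by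
        simpa using (hasDerivAt_id x).const_mul (2 / h ^ 2)
      refine ((h1.exp.const_mul M₀).add (((h1.pow (n + 1)).div_const
        ((n + 1).factorial : ℝ)).const_mul (Real.exp (2 / h ^ 2 * T) * M))).congr_deriv ?_
      have : (n.factorial : ℝ) ≠ 0 := by positivity
      rw [Nat.factorial_succ]
      push_cast
      field_simp
    · intro x hx
      have hx' : x ∈ Icc 0 T := ⟨hx.1, hx.2.le⟩
      rw [norm_mul, Complex.norm_real, Real.norm_of_nonneg (by positivity)]
      have h1 := ih x hx' (k + 1)
      have h2 := ih x hx' (k - 1)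
      calc _ ≤ 1 / h ^ 2 * (_ + _) := by
            gcongr
            exact (norm_add_le _ _).trans (add_le_add h1 h2)
        _ = _ := by ring

/-- Maximum principle for the discrete heat equation. -/
theorem norm_le {h : ℝ} {v : ℝ → ℤ → ℂ} (hv : IsDiscreteHeatSolution h v)
    {M₀ : ℝ} (h0 : ∀ k, ‖v 0 k‖ ≤ M₀) {t : ℝ} (ht : 0 ≤ t) (k : ℤ) : ‖v t k‖ ≤ M₀ := by
  obtain ⟨M, hM⟩ := hv.bounded t
  have hlim : Tendsto (fun n : ℕ => M₀ * Real.exp (2 / h ^ 2 * t) +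
      Real.exp (2 / h ^ 2 * t) * M * ((2 / h ^ 2 * t) ^ n / n.factorial)) atTop
      (𝓝 (M₀ * Real.exp (2 / h ^ 2 * t) + Real.exp (2 / h ^ 2 * t) * M * 0)) :=
    ((FloorSemiring.tendsto_pow_div_factorial_atTop _).const_mul _).const_add _
  have := ge_of_tendsto' hlim fun n => hv.norm_exp_mul_le h0 hM n t ⟨ht, le_rfl⟩ k
  rw [norm_mul, Complex.norm_real, Real.norm_of_nonneg (Real.exp_pos _).le, mul_zero, add_zero,
    mul_comm] at this
  exact le_of_mul_le_mul_right this (Real.exp_pos _)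

end IsDiscreteHeatSolution

/-! ### Bounds for modified Bessel functions -/

/-- Shifting the contour in the integral of a `2π`-periodic entire function over a period. -/
theorem integral_period_shift {f : ℂ → ℂ} (hf : Differentiable ℂ f)
    (hper : ∀ z, f (z + 2 * Real.pi) = f z) (l : ℝ) :
    ∫ x in (-Real.pi)..Real.pi, f x = ∫ x in (-Real.pi)..Real.pi, f (x + l * Complex.I) := by
  have h := Complex.integral_boundary_rect_eq_zero_of_differentiableOn f
    (-Real.pi : ℂ) (Real.pi + l * Complex.I) hf.differentiableOn
  have hside : ∀ y : ℝ, f (Real.pi + y * Complex.I) = f (-Real.pi + y * Complex.I) := fun y => by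
    rw [← hper (-Real.pi + y * Complex.I)]
    congr 1
    ring
  simp only [Complex.add_re, Complex.add_im, Complex.neg_re, Complex.neg_im, Complex.ofReal_re,
    Complex.ofReal_im, Complex.mul_re, Complex.mul_im, Complex.I_re, Complex.I_im, mul_zero,
    mul_one, zero_mul, add_zero, zero_add, neg_zero, Complex.ofReal_zero,
    Complex.ofReal_neg, hside, add_sub_cancel_right, sub_self] at h
  exact sub_eq_zero.1 h

theorem besselI_integrand_continuous (k : ℤ) (x : ℝ) :
    Continuous fun θ : ℝ => Real.exp (x * Real.cos θ) * Real.cos (k * θ) := by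
  fun_prop

theorem besselI_eq_symm_integral (k : ℤ) (x : ℝ) :
    besselI k x = (1 / (2 * Real.pi)) *
      ∫ θ in (-Real.pi)..Real.pi, Real.exp (x * Real.cos θ) * Real.cos (k * θ) := by
  have hc := besselI_integrand_continuous k x
  have hneg : ∫ θ in (-Real.pi)..0, Real.exp (x * Real.cos θ) * Real.cos (k * θ) =
      ∫ θ in (0 : ℝ)..Real.pi, Real.exp (x * Real.cos θ) * Real.cos (k * θ) := by
    have := intervalIntegral.integral_comp_neg (a := 0) (b := Real.pi)
      fun θ : ℝ => Real.exp (x * Real.cos θ) * Real.cos (k * θ)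
    simpa using this.symm
  rw [← intervalIntegral.integral_add_adjacent_intervals (hc.intervalIntegrable _ 0)
    (hc.intervalIntegrable _ _), hneg, besselI]
  field_simp
  ring

theorem besselI_zero_pos (x : ℝ) : 0 < besselI 0 x := by
  have : 0 < ∫ θ in (0 : ℝ)..Real.pi, Real.exp (x * Real.cos θ) * Real.cos ((0 : ℤ) * θ) := by
    refine intervalIntegral.intervalIntegral_pos_of_pos_on
      ((besselI_integrand_continuous 0 x).intervalIntegrable _ _) (fun θ _ => ?_) Real.pi_pos
    simpa using Real.exp_pos _
  exact mul_pos (by positivity) this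

/-- Needed for `α < 0`, where the decay hypothesis at `k = 1` then forces `C = 0`. Subtracting `∫
cos = 0` makes the integrand of one sign. -/
theorem besselI_one_neg {x : ℝ} (hx : x < 0) : besselI 1 x < 0 := by
  have hc := besselI_integrand_continuous 1 x
  have hcos : ∫ θ in (0 : ℝ)..Real.pi, Real.cos θ = 0 := by simp
  have : 0 < ∫ θ in (0 : ℝ)..Real.pi, (1 - Real.exp (x * Real.cos θ)) * Real.cos θ := by
    refine intervalIntegral.integral_pos Real.pi_pos (by fun_prop) (fun θ _ => ?_)
      ⟨0, ⟨le_rfl, Real.pi_pos.le⟩, ?_⟩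
    · rcases le_total 0 (Real.cos θ) with h | h
      · have : Real.exp (x * Real.cos θ) ≤ 1 :=
          Real.exp_le_one_iff.2 (mul_nonpos_of_nonpos_of_nonneg hx.le h)
        exact mul_nonneg (by linarith) h
      · have : 1 ≤ Real.exp (x * Real.cos θ) := Real.one_le_exp (mul_nonneg_of_nonpos_of_nonpos hx.le h)
        exact mul_nonneg_of_nonpos_of_nonpos (by linarith) h
    · simpa using hx
  have heq : ∫ θ in (0 : ℝ)..Real.pi, (1 - Real.exp (x * Real.cos θ)) * Real.cos θ =
      -∫ θ in (0 : ℝ)..Real.pi, Real.exp (x * Real.cos θ) * Real.cos ((1 : ℤ) * θ) := by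
    have h2 : (fun θ => (1 - Real.exp (x * Real.cos θ)) * Real.cos θ) = fun θ =>
        Real.cos θ - Real.exp (x * Real.cos θ) * Real.cos ((1 : ℤ) * θ) := by
      funext θ
      simp only [Int.cast_one, one_mul]
      ring
    rw [h2, intervalIntegral.integral_sub (Real.continuous_cos.intervalIntegrable _ _)
      (hc.intervalIntegrable _ _), hcos, zero_sub]
  rw [heq] at this
  exact mul_neg_of_pos_of_neg (by positivity) (by linarith)

/-- Shift the contour of `exp (x cos z + i k z)` to height `l`: the factor `exp (i k z)` contributes
`exp (-k l)` in modulus, and `Re cos (θ + i l) = cos θ cosh l`. -/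
theorem besselI_le_exp_mul_besselI_zero (k : ℤ) (x l : ℝ) :
    besselI k x ≤ Real.exp (-(k * l)) * besselI 0 (x * Real.cosh l) := by
  set f : ℂ → ℂ := fun z => Complex.exp (x * Complex.cos z + k * z * Complex.I) with hf
  have hfd : Differentiable ℂ f := by fun_prop
  have hper : ∀ z, f (z + 2 * Real.pi) = f z := fun z => by
    simp only [hf, Complex.cos_add_two_pi]
    rw [show (x * Complex.cos z + k * (z + 2 * Real.pi) * Complex.I : ℂ) =
      x * Complex.cos z + k * z * Complex.I + k * (2 * Real.pi * Complex.I) by ring,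
      Complex.exp_add, Complex.exp_int_mul_two_pi_mul_I, mul_one]
  have hnorm : ∀ θ m : ℝ, ‖f (θ + m * Complex.I)‖ =
      Real.exp (-(k * m)) * Real.exp (x * Real.cosh m * Real.cos θ) := fun θ m => by
    rw [hf, Complex.norm_exp, ← Real.exp_add]
    congr 1
    have hcos : (Complex.cos (θ + m * Complex.I)).re = Real.cos θ * Real.cosh m := by
      rw [Complex.cos_add_mul_I, ← Complex.ofReal_cos, ← Complex.ofReal_sin, ← Complex.ofReal_cosh,
        ← Complex.ofReal_sinh, ← Complex.ofReal_mul, ← Complex.ofReal_mul, Complex.sub_re,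
        Complex.ofReal_re, Complex.re_ofReal_mul, Complex.I_re, mul_zero, sub_zero]
    rw [Complex.add_re, Complex.re_ofReal_mul, hcos]
    simp
    ring
  have hre : ∀ θ : ℝ, (f θ).re = Real.exp (x * Real.cos θ) * Real.cos (k * θ) := fun θ => by
    have hre : (x * Complex.cos θ + k * θ * Complex.I : ℂ).re = x * Real.cos θ := by
      rw [Complex.add_re, Complex.re_ofReal_mul, Complex.cos_ofReal_re]
      simp
    have him : (x * Complex.cos θ + k * θ * Complex.I : ℂ).im = k * θ := by
      rw [Complex.add_im, Complex.im_ofReal_mul, Complex.cos_ofReal_im]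
      simp
    simp only [hf]
    rw [Complex.exp_re, hre, him]
  rw [besselI_eq_symm_integral, besselI_eq_symm_integral, mul_left_comm]
  gcongr
  calc ∫ θ in (-Real.pi)..Real.pi, Real.exp (x * Real.cos θ) * Real.cos (k * θ)
      = (∫ θ in (-Real.pi)..Real.pi, f θ).re := by
        simp_rw [← hre]
        exact Complex.reCLM.intervalIntegral_comp_comm
          ((hfd.continuous.comp Complex.continuous_ofReal).intervalIntegrable _ _)
    _ ≤ ‖∫ θ in (-Real.pi)..Real.pi, f (θ + l * Complex.I)‖ := by
        rw [integral_period_shift hfd hper l]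
        exact Complex.re_le_norm _
    _ ≤ ∫ θ in (-Real.pi)..Real.pi, ‖f (θ + l * Complex.I)‖ :=
        intervalIntegral.norm_integral_le_integral_norm (by linarith [Real.pi_pos])
    _ = _ := by
        simp_rw [hnorm]
        rw [intervalIntegral.integral_const_mul]
        simp

theorem besselI_zero_le_exp_sub_mul {x y : ℝ} (hxy : x ≤ y) :
    besselI 0 y ≤ Real.exp (y - x) * besselI 0 x := by
  have hle : ∫ θ in (0 : ℝ)..Real.pi, Real.exp (y * Real.cos θ) * Real.cos ((0 : ℤ) * θ) ≤
      Real.exp (y - x) *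
        ∫ θ in (0 : ℝ)..Real.pi, Real.exp (x * Real.cos θ) * Real.cos ((0 : ℤ) * θ) := by
    rw [← intervalIntegral.integral_const_mul]
    refine intervalIntegral.integral_mono_on Real.pi_pos.le
      ((besselI_integrand_continuous 0 y).intervalIntegrable _ _)
      (((besselI_integrand_continuous 0 x).const_mul _).intervalIntegrable _ _) fun θ _ => ?_
    simp only [Int.cast_zero, zero_mul, Real.cos_zero, mul_one, ← Real.exp_add]
    have := mul_le_mul_of_nonneg_left (Real.cos_le_one θ) (sub_nonneg.2 hxy)
    gcongr
    linarith
  rw [besselI, besselI, mul_left_comm]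
  gcongr

/-- Gaussian-type upper bound for the ratio of Bessel functions. -/
theorem besselI_div_besselI_zero_le (k : ℤ) {x : ℝ} (hx : 0 ≤ x) (l : ℝ) :
    besselI k x / besselI 0 x ≤ Real.exp (-(k * l) + x * (Real.cosh l - 1)) := by
  rw [div_le_iff₀ (besselI_zero_pos x), Real.exp_add, mul_assoc]
  refine (besselI_le_exp_mul_besselI_zero k x l).trans ?_
  gcongr
  rw [mul_sub_one]
  exact besselI_zero_le_exp_sub_mul (le_mul_of_one_le_right hx (Real.one_le_cosh l))

/-! ### Fourier inversion for integrable functions and Sobolev functions -/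

theorem integral_fourierInv_mul_eq {f g : ℝ → ℂ} (hf : Integrable f) (hg : Integrable g) :
    ∫ x, 𝓕⁻ f x * g x = ∫ x, f x * 𝓕⁻ g x := by
  have h := VectorFourier.integral_fourierIntegral_smul_eq_flip (e := Real.fourierChar)
    (L := -innerₗ ℝ) (μ := volume) (ν := volume) Real.continuous_fourierChar
    (by simp; fun_prop) hf hg
  have hflip : (-innerₗ ℝ : ℝ →ₗ[ℝ] ℝ →ₗ[ℝ] ℝ).flip = -innerₗ ℝ := by
    ext
    simp
  rw [hflip] at h
  exact h

theorem continuous_fourierInv_of_integrable {f : ℝ → ℂ} (hf : Integrable f) :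
    Continuous (𝓕⁻ f) :=
  VectorFourier.fourierIntegral_continuous (e := Real.fourierChar) (L := -innerₗ ℝ)
    Real.continuous_fourierChar (by simp; fun_prop) hf

/-- The inverse Fourier transform is injective on integrable functions. -/
theorem ae_eq_zero_of_fourierInv_eq_zero {f : ℝ → ℂ} (hf : Integrable f)
    (h : ∀ x, 𝓕⁻ f x = 0) : f =ᵐ[volume] 0 := by
  refine ae_eq_zero_of_integral_contDiff_smul_eq_zero hf.locallyIntegrable fun g hg hgc => ?_
  have hg₁ : HasCompactSupport (Complex.ofRealCLM ∘ g) := hgc.comp_left rfl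
  have hg₂ : ContDiff ℝ (⊤ : ℕ∞) (Complex.ofRealCLM ∘ g) := Complex.ofRealCLM.contDiff.comp hg
  set ψ : 𝓢(ℝ, ℂ) := hg₁.toSchwartzMap hg₂ with hψ
  have hψg : ∀ x, ψ x = g x := fun x => rfl
  have hinv : ∀ x, 𝓕⁻ (⇑(𝓕 ψ : 𝓢(ℝ, ℂ))) x = g x := fun x => by
    rw [← SchwartzMap.fourierInv_coe, FourierTransform.fourierInv_fourier_eq, hψg]
  -- Every test function is the inverse transform of a Schwartz function, so the multiplication
  -- formula moves the transform onto `f`.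
  calc ∫ x, g x • f x = ∫ x, 𝓕⁻ (⇑(𝓕 ψ : 𝓢(ℝ, ℂ))) x * f x := by
        simp_rw [hinv, Complex.real_smul]
    _ = ∫ x, (𝓕 ψ : 𝓢(ℝ, ℂ)) x * 𝓕⁻ f x := integral_fourierInv_mul_eq (𝓕 ψ : 𝓢(ℝ, ℂ)).integrable hf
    _ = 0 := by simp [h]

/-- A continuous `H^s` function with `s > 1/2` is the inverse Fourier transform of an integrable
function. -/
theorem IsContinuousSobolev.exists_fourierInv_eq {s : ℝ} (hs : 1 / 2 < s) {u : ℝ → ℂ}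
    (hu : IsContinuousSobolev s u) : ∃ g : ℝ → ℂ, Integrable g ∧ ∀ x, u x = 𝓕⁻ g x := by
  obtain ⟨huc, hu2, hus⟩ := hu
  -- As `s` exceeds half the dimension, the weight `(1 + |ξ|²)^(-s/2)` is square integrable, and
  -- Cauchy–Schwarz puts the transform in `L¹`.
  obtain ⟨g, hg⟩ := hus.fourier_memL1 (by simp; linarith)
  have hgi : Integrable (g : ℝ → ℂ) := L1.integrable_coeFn g
  refine ⟨g, hgi, fun x => ?_⟩
  have hae : u =ᵐ[volume] 𝓕⁻ (g : ℝ → ℂ) := by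
    refine ae_eq_of_integral_contDiff_smul_eq huc.locallyIntegrable
      (continuous_fourierInv_of_integrable hgi).locallyIntegrable fun χ hχ hχc => ?_
    have hχ₁ : HasCompactSupport (Complex.ofRealCLM ∘ χ) := hχc.comp_left rfl
    have hχ₂ : ContDiff ℝ (⊤ : ℕ∞) (Complex.ofRealCLM ∘ χ) := Complex.ofRealCLM.contDiff.comp hχ
    set ψ : 𝓢(ℝ, ℂ) := hχ₁.toSchwartzMap hχ₂ with hψ
    have hψχ : ∀ x, ψ x = χ x := fun x => rfl
    have h1 := congrArg (fun T : 𝓢'(ℝ, ℂ) => T (𝓕⁻ ψ)) hg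
    simp only [TemperedDistribution.fourier_apply, FourierTransform.fourier_fourierInv_eq,
      Lp.toTemperedDistribution_apply, smul_eq_mul] at h1
    calc ∫ x, χ x • u x = ∫ x, ψ x * (hu2.toLp u : ℝ → ℂ) x := by
          refine integral_congr_ae ?_
          filter_upwards [hu2.coeFn_toLp] with x hx
          rw [hx, hψχ, Complex.real_smul]
      _ = ∫ x, 𝓕⁻ (⇑ψ) x * g x := by rw [h1, SchwartzMap.fourierInv_coe]
      _ = ∫ x, ψ x * 𝓕⁻ (g : ℝ → ℂ) x := integral_fourierInv_mul_eq ψ.integrable hgi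
      _ = _ := by simp_rw [hψχ, Complex.real_smul]
  exact congrFun ((huc.ae_eq_iff_eq _ (continuous_fourierInv_of_integrable hgi)).1 hae) x

/-! ### Phragmén–Lindelöf and Hardy's uncertainty principle -/

theorem norm_mul_exp_sq (a : ℝ) (w z : ℂ) :
    ‖w * Complex.exp (a * z ^ 2)‖ = ‖w‖ * Real.exp (a * (z.re ^ 2 - z.im ^ 2)) := by
  rw [norm_mul, Complex.norm_exp]
  congr 2
  simp [pow_two]

/-- Phragmén–Lindelöf estimate in the closed first quadrant, for a function whose growth is of
order two but whose type on the imaginary axis is compensated by its Gaussian decay on the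
real axis. -/
theorem norm_mul_exp_sq_le_of_quadrant {f : ℂ → ℂ} (hf : Differentiable ℂ f) {a A C : ℝ}
    (ha : 1 / 4 < a) (hA : ∀ z, ‖f z‖ ≤ A * Real.exp (z.im ^ 2 / 4))
    (hC : ∀ x : ℝ, ‖f x‖ ≤ C * Real.exp (-(a * x ^ 2))) {z : ℂ} (hre : 0 ≤ z.re)
    (him : 0 ≤ z.im) : ‖f z * Complex.exp (a * z ^ 2)‖ ≤ max A C := by
  have hA0 : 0 ≤ A := by simpa using (norm_nonneg _).trans (hA 0)
  -- Near the imaginary axis the growth bound alone suffices: the total exponent `y² / 4 + a (x² -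
  -- y²)` is nonpositive there.
  have hnear : ∀ z : ℂ, a * z.re ^ 2 ≤ (a - 1 / 4) * z.im ^ 2 →
      ‖f z * Complex.exp (a * z ^ 2)‖ ≤ max A C := fun z hz => by
    rw [norm_mul_exp_sq]
    calc ‖f z‖ * Real.exp (a * (z.re ^ 2 - z.im ^ 2))
        ≤ A * Real.exp (z.im ^ 2 / 4) * Real.exp (a * (z.re ^ 2 - z.im ^ 2)) := by
          gcongr
          exact hA z
      _ = A * Real.exp (z.im ^ 2 / 4 + a * (z.re ^ 2 - z.im ^ 2)) := by
          rw [mul_assoc, Real.exp_add]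
      _ ≤ A * 1 := by
          gcongr
          exact Real.exp_le_one_iff.2 (by linarith)
      _ ≤ max A C := by simp
  rcases le_or_gt (a * z.re ^ 2) ((a - 1 / 4) * z.im ^ 2) with h | h
  · exact hnear z h
  have ha' : 0 < a - 1 / 4 := by linarith
  have hre' : 0 < z.re := by
    rcases hre.eq_or_lt with h0 | h0
    · rw [← h0] at h
      nlinarith [mul_nonneg ha'.le (sq_nonneg z.im)]
    · exact h0
  -- `√q` is the slope of the ray where that exponent vanishes. The remaining sector has opening `θ
  -- < π / 2`, so growth of order `2 < π / θ` is admissible for Phragmén–Lindelöf; `exp` maps the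
  -- strip of width `θ` onto the sector.
  set q : ℝ := a / (a - 1 / 4) with hq
  have hq0 : 0 < q := div_pos (by linarith) ha'
  set θ : ℝ := Real.arctan √q with hθ
  have hθpos : 0 < θ := Real.arctan_pos.2 (Real.sqrt_pos.2 hq0)
  have hθlt : θ < Real.pi / 2 := Real.arctan_lt_pi_div_two _
  have hsin : (a - 1 / 4) * Real.sin θ ^ 2 = a * Real.cos θ ^ 2 := by
    have hc : Real.cos θ ≠ 0 := (Real.cos_arctan_pos _).ne'
    have ht : Real.sin θ = √q * Real.cos θ := by
      rw [← Real.tan_mul_cos hc, hθ, Real.tan_arctan]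
    rw [ht, mul_pow, Real.sq_sqrt hq0.le, ← mul_assoc, hq, mul_div_cancel₀ _ ha'.ne']
  have hz0 : z ≠ 0 := fun h0 => by simp [h0] at hre'
  have hexp : ∀ ζ : ℂ, (Complex.exp ζ).re ^ 2 + (Complex.exp ζ).im ^ 2 =
      Real.exp (2 * ζ.re) := fun ζ => by
    rw [Complex.exp_re, Complex.exp_im, mul_pow, mul_pow, ← mul_add, Real.cos_sq_add_sin_sq,
      mul_one, ← Real.exp_nat_mul]
    norm_num
  have hstrip := PhragmenLindelof.horizontal_strip (a := 0) (b := θ) (C := max A C)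
    (f := fun ζ => f (Complex.exp ζ) * Complex.exp (a * Complex.exp ζ ^ 2)) (z := Complex.log z)
    (by
      apply Differentiable.diffContOnCl
      fun_prop)
    ⟨2, by
      rw [sub_zero, lt_div_iff₀ hθpos]
      linarith, a + 1 / 4, ?_⟩ ?_ ?_ ?_ ?_
  · simpa [Complex.exp_log hz0] using hstrip
  · refine Asymptotics.IsBigO.of_bound A (Eventually.of_forall fun ζ => ?_)
    rw [norm_mul_exp_sq, Real.norm_of_nonneg (Real.exp_pos _).le]
    set w := Complex.exp ζ with hw
    have h1 : w.re ^ 2 + w.im ^ 2 ≤ Real.exp (2 * |ζ.re|) := by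
      rw [hexp]
      gcongr
      exact le_abs_self _
    calc ‖f w‖ * Real.exp (a * (w.re ^ 2 - w.im ^ 2))
        ≤ A * Real.exp (w.im ^ 2 / 4) * Real.exp (a * (w.re ^ 2 - w.im ^ 2)) := by
          gcongr
          exact hA w
      _ = A * Real.exp (w.im ^ 2 / 4 + a * (w.re ^ 2 - w.im ^ 2)) := by
          rw [mul_assoc, Real.exp_add]
      _ ≤ _ := by
          gcongr
          have h2 := mul_le_mul_of_nonneg_left h1 (by linarith : 0 ≤ a + 1 / 4)
          nlinarith [mul_nonneg (by linarith : 0 ≤ a) (sq_nonneg w.im), sq_nonneg w.re]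
  · intro ζ hζ
    have him : (Complex.exp ζ).im = 0 := by simp [Complex.exp_im, hζ]
    have hw : Complex.exp ζ = ((Complex.exp ζ).re : ℂ) := Complex.ext (by simp) (by simp [him])
    rw [norm_mul_exp_sq, him, hw]
    calc _ ≤ C * Real.exp (-(a * (Complex.exp ζ).re ^ 2)) * _ :=
          mul_le_mul_of_nonneg_right (hC _) (Real.exp_pos _).le
      _ = C := by
          rw [mul_assoc, ← Real.exp_add]
          simp
      _ ≤ _ := le_max_right _ _
  · intro ζ hζ
    apply hnear
    rw [Complex.exp_re, Complex.exp_im, hζ, mul_pow, mul_pow]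
    nlinarith [hsin, sq_nonneg (Real.exp ζ.re)]
  · rw [Complex.log_im]
    exact Complex.arg_nonneg_iff.2 him
  · rw [Complex.log_im]
    by_contra! hlt
    have harg : z.arg < Real.pi / 2 :=
      (le_abs_self _).trans_lt (Complex.abs_arg_lt_pi_div_two_iff.2 (Or.inl hre'))
    have htan := Real.tan_lt_tan_of_lt_of_lt_pi_div_two (by linarith [Real.pi_pos]) harg hlt
    rw [Complex.tan_arg, hθ, Real.tan_arctan] at htan
    have hlt' := Real.lt_sq_of_sqrt_lt htan
    rw [hq, div_pow, div_lt_div_iff₀ ha' (by positivity)] at hlt'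
    linarith

/-- Hardy's uncertainty principle, in the form of a uniqueness theorem for entire functions. -/
theorem eq_zero_of_gaussian_bounds {f : ℂ → ℂ} (hf : Differentiable ℂ f) {a A C : ℝ}
    (ha : 1 / 4 < a) (hA : ∀ z, ‖f z‖ ≤ A * Real.exp (z.im ^ 2 / 4))
    (hC : ∀ x : ℝ, ‖f x‖ ≤ C * Real.exp (-(a * x ^ 2))) (z : ℂ) : f z = 0 := by
  set G : ℂ → ℂ := fun z => f z * Complex.exp (a * z ^ 2) with hG
  have hGd : Differentiable ℂ G := by fun_prop
  have hright : ∀ g : ℂ → ℂ, Differentiable ℂ g →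
      (∀ z, ‖g z‖ ≤ A * Real.exp (z.im ^ 2 / 4)) →
      (∀ x : ℝ, ‖g x‖ ≤ C * Real.exp (-(a * x ^ 2))) → ∀ z : ℂ, 0 ≤ z.re →
      ‖g z * Complex.exp (a * z ^ 2)‖ ≤ max A C := fun g hg hgA hgC z hz => by
    rcases le_total 0 z.im with him | him
    · exact norm_mul_exp_sq_le_of_quadrant hg ha hgA hgC hz him
    -- The fourth quadrant reduces to the first by the reflection `z ↦ conj (g (conj z))`.
    · have := norm_mul_exp_sq_le_of_quadrant
        (f := fun z => (starRingEnd ℂ) (g ((starRingEnd ℂ) z)))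
        (z := (starRingEnd ℂ) z) (fun z => differentiableAt_conj_conj_iff.2 (hg _)) ha
        (fun z => by simpa using hgA ((starRingEnd ℂ) z)) (fun x => by simpa using hgC x)
        (by simpa using hz) (by simpa using him)
      rw [norm_mul_exp_sq] at this ⊢
      simpa only [Complex.conj_conj, RCLike.norm_conj, Complex.conj_re, Complex.conj_im,
        neg_sq] using this
  have hbound : ∀ z, ‖G z‖ ≤ max A C := fun z => by
    rcases le_total 0 z.re with hre | hre
    · exact hright f hf hA hC z hre
    · simpa [hG] using hright (fun z => f (-z)) (by fun_prop) (fun z => by simpa using hA (-z))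
        (fun x => by simpa using hC (-x)) (-z) (by simpa using hre)
  have hGb : Bornology.IsBounded (range G) := by
    rw [isBounded_iff_forall_norm_le]
    exact ⟨max A C, by rintro _ ⟨z, rfl⟩; exact hbound z⟩
  -- `G` is bounded, hence constant by Liouville; its value is read off along the imaginary axis,
  -- where it tends to zero.
  have hlim : Tendsto (fun y : ℝ => A * Real.exp (-((a - 1 / 4) * y ^ 2))) atTop (𝓝 (A * 0)) := by
    refine (Real.tendsto_exp_atBot.comp ?_).const_mul A
    exact tendsto_neg_atTop_atBot.comp
      ((tendsto_pow_atTop two_ne_zero).const_mul_atTop (by linarith))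
  have hzero : ‖G z‖ ≤ A * 0 := by
    refine ge_of_tendsto' hlim fun y => ?_
    rw [hGd.apply_eq_apply_of_bounded hGb z (y * Complex.I), hG]
    simp only
    rw [norm_mul_exp_sq]
    calc _ ≤ A * Real.exp ((y * Complex.I : ℂ).im ^ 2 / 4) * _ :=
          mul_le_mul_of_nonneg_right (hA _) (Real.exp_pos _).le
      _ = _ := by
          rw [mul_assoc, ← Real.exp_add]
          congr 2
          simp
          ring
  have : G z = 0 := by simpa using hzero
  exact (mul_eq_zero.1 this).resolve_right (Complex.exp_ne_zero _)

/-! ### Fourier representation of the discrete and continuous heat flows -/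

noncomputable section

/-- The Fourier symbol of the discrete Laplacian with mesh size `h`. -/
def latticeSymbol (h ξ : ℝ) : ℝ := -(2 * (Real.sin (Real.pi * ξ * h) / h)) ^ 2

/-- The solution of the discrete heat equation whose initial datum is the inverse Fourier transform
of `g`, as a function of time and position. -/
def latticeWave (g : ℝ → ℂ) (h t x : ℝ) : ℂ :=
  ∫ ξ : ℝ, g ξ * Complex.exp ((2 * Real.pi * ξ * x : ℝ) * Complex.I + (t * latticeSymbol h ξ : ℝ))

/-- The entire extension of the solution at time one of the heat equation whose initial datum is
the inverse Fourier transform of `g`. -/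
def heatExtension (g : ℝ → ℂ) (z : ℂ) : ℂ :=
  ∫ ξ : ℝ, g ξ * Complex.exp ((2 * Real.pi * ξ : ℝ) * z * Complex.I - ((2 * Real.pi * ξ) ^ 2 : ℝ))

end

theorem fourierInv_eq_integral_mul_exp (g : ℝ → ℂ) (x : ℝ) :
    FourierTransform.fourierInv g x =
      ∫ ξ : ℝ, g ξ * Complex.exp ((2 * Real.pi * ξ * x : ℝ) * Complex.I) := by
  rw [Real.fourierInv_eq']
  refine integral_congr_ae (Eventually.of_forall fun ξ => ?_)
  simp only [smul_eq_mul]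
  rw [mul_comm (g ξ)]
  congr 4
  simp
  ring

theorem latticeSymbol_nonpos (h ξ : ℝ) : latticeSymbol h ξ ≤ 0 := by
  rw [latticeSymbol]
  exact neg_nonpos.2 (sq_nonneg _)

theorem abs_latticeSymbol_le (h ξ : ℝ) : |latticeSymbol h ξ| ≤ 4 / h ^ 2 := by
  rw [latticeSymbol, abs_neg, abs_of_nonneg (sq_nonneg _), mul_pow, div_pow,
    show (4 : ℝ) / h ^ 2 = 2 ^ 2 * (1 / h ^ 2) by ring]
  gcongr
  exact Real.sin_sq_le_one _

theorem continuous_latticeSymbol (h : ℝ) : Continuous (latticeSymbol h) := by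
  unfold latticeSymbol
  fun_prop

theorem tendsto_latticeSymbol (ξ : ℝ) :
    Tendsto (fun h => latticeSymbol h ξ) (𝓝[>] 0) (𝓝 (-(2 * Real.pi * ξ) ^ 2)) := by
  have hd : HasDerivAt (fun h : ℝ => Real.sin (Real.pi * ξ * h)) (Real.pi * ξ) 0 := by
    simpa using ((hasDerivAt_id (0 : ℝ)).const_mul (Real.pi * ξ)).sin
  have h1 := hd.tendsto_slope_zero_right
  simp only [zero_add, mul_zero, Real.sin_zero, sub_zero, smul_eq_mul] at h1
  convert! ((h1.const_mul 2).pow 2).neg using 1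
  · funext h
    rw [latticeSymbol]
    ring
  · ring_nf

theorem norm_latticeWave_integrand (g : ℝ → ℂ) (h t x ξ : ℝ) :
    ‖g ξ * Complex.exp ((2 * Real.pi * ξ * x : ℝ) * Complex.I + (t * latticeSymbol h ξ : ℝ))‖ =
      ‖g ξ‖ * Real.exp (t * latticeSymbol h ξ) := by
  rw [norm_mul, Complex.norm_exp, Complex.add_re, Complex.re_ofReal_mul, Complex.I_re, mul_zero,
    zero_add, Complex.ofReal_re]

theorem norm_latticeWave_integrand_le (g : ℝ → ℂ) (h x ξ : ℝ) {t : ℝ} (ht : 0 ≤ t) :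
    ‖g ξ * Complex.exp ((2 * Real.pi * ξ * x : ℝ) * Complex.I + (t * latticeSymbol h ξ : ℝ))‖ ≤
      ‖g ξ‖ := by
  rw [norm_latticeWave_integrand]
  exact mul_le_of_le_one_right (norm_nonneg _)
    (Real.exp_le_one_iff.2 (mul_nonpos_of_nonneg_of_nonpos ht (latticeSymbol_nonpos h ξ)))

theorem aestronglyMeasurable_latticeWave_integrand {g : ℝ → ℂ} (hg : Integrable g) (h t x : ℝ) :
    AEStronglyMeasurable (fun ξ : ℝ => g ξ *
      Complex.exp ((2 * Real.pi * ξ * x : ℝ) * Complex.I + (t * latticeSymbol h ξ : ℝ))) := by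
  have := continuous_latticeSymbol h
  exact hg.aestronglyMeasurable.mul (by fun_prop : Continuous _).aestronglyMeasurable

theorem integrable_latticeWave_integrand {g : ℝ → ℂ} (hg : Integrable g) (h x : ℝ) {t : ℝ}
    (ht : 0 ≤ t) : Integrable (fun ξ : ℝ => g ξ *
      Complex.exp ((2 * Real.pi * ξ * x : ℝ) * Complex.I + (t * latticeSymbol h ξ : ℝ))) :=
  hg.norm.mono' (aestronglyMeasurable_latticeWave_integrand hg h t x)
    (Eventually.of_forall fun ξ => norm_latticeWave_integrand_le g h x ξ ht)

theorem latticeWave_zero (g : ℝ → ℂ) (h x : ℝ) :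
    latticeWave g h 0 x = FourierTransform.fourierInv g x := by
  simp [latticeWave, fourierInv_eq_integral_mul_exp]

/-- The exponential `exp (i y)` with `y = 2 π ξ x` is an eigenfunction of the discrete Laplacian. -/
theorem discreteLaplacian_exp (h ξ : ℝ) (k : ℤ) :
    (Complex.exp ((2 * Real.pi * ξ * ((k + 1 : ℤ) * h) : ℝ) * Complex.I) -
      2 * Complex.exp ((2 * Real.pi * ξ * (k * h) : ℝ) * Complex.I) +
      Complex.exp ((2 * Real.pi * ξ * ((k - 1 : ℤ) * h) : ℝ) * Complex.I)) / (h : ℂ) ^ 2 =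
    (latticeSymbol h ξ : ℂ) * Complex.exp ((2 * Real.pi * ξ * (k * h) : ℝ) * Complex.I) := by
  have hsin : (latticeSymbol h ξ : ℂ) = (Complex.exp ((2 * Real.pi * ξ * h : ℝ) * Complex.I) - 2 +
      Complex.exp (-((2 * Real.pi * ξ * h : ℝ) * Complex.I))) / (h : ℂ) ^ 2 := by
    rw [show Complex.exp ((2 * Real.pi * ξ * h : ℝ) * Complex.I) - 2 +
        Complex.exp (-((2 * Real.pi * ξ * h : ℝ) * Complex.I)) =
        ((2 * Real.cos (2 * (Real.pi * ξ * h)) - 2 : ℝ) : ℂ) by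
      push_cast
      rw [show (2 * (Real.pi * ξ * h) : ℂ) = 2 * Real.pi * ξ * h by ring, Complex.two_cos]
      ring_nf]
    rw [Real.cos_two_mul, Real.cos_sq', latticeSymbol]
    push_cast
    ring
  have h1 : ((2 * Real.pi * ξ * ((k + 1 : ℤ) * h) : ℝ) * Complex.I : ℂ) =
      (2 * Real.pi * ξ * (k * h) : ℝ) * Complex.I + (2 * Real.pi * ξ * h : ℝ) * Complex.I := by
    push_cast
    ring
  have h2 : ((2 * Real.pi * ξ * ((k - 1 : ℤ) * h) : ℝ) * Complex.I : ℂ) =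
      (2 * Real.pi * ξ * (k * h) : ℝ) * Complex.I + -((2 * Real.pi * ξ * h : ℝ) * Complex.I) := by
    push_cast
    ring
  rw [h1, h2, Complex.exp_add, Complex.exp_add, hsin]
  ring

theorem integral_sub_two_mul_add {f₁ f₂ f₃ : ℝ → ℂ} (h₁ : Integrable f₁) (h₂ : Integrable f₂)
    (h₃ : Integrable f₃) :
    ∫ x, (f₁ x - 2 * f₂ x + f₃ x) = (∫ x, f₁ x) - 2 * (∫ x, f₂ x) + ∫ x, f₃ x := by
  rw [← integral_const_mul, ← integral_sub h₁ (h₂.const_mul 2)]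
  exact integral_add (h₁.sub (h₂.const_mul 2)) h₃

theorem isDiscreteHeatSolution_latticeWave {g : ℝ → ℂ} (hg : Integrable g) (h : ℝ) :
    IsDiscreteHeatSolution h (fun t k => latticeWave g h t (k * h)) where
  bounded T := ⟨∫ ξ, ‖g ξ‖, fun t ht k => norm_integral_le_of_norm_le hg.norm
    (Eventually.of_forall fun ξ => norm_latticeWave_integrand_le g h _ ξ ht.1)⟩
  heat t ht k := by
    have hsymb := continuous_latticeSymbol h
    have hderiv := (hasDerivAt_integral_of_dominated_loc_of_deriv_le
      (F := fun (τ : ℝ) (ξ : ℝ) => g ξ *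
        Complex.exp ((2 * Real.pi * ξ * (k * h) : ℝ) * Complex.I + (τ * latticeSymbol h ξ : ℝ)))
      (F' := fun (τ : ℝ) (ξ : ℝ) => g ξ * (Complex.exp ((2 * Real.pi * ξ * (k * h) : ℝ) * Complex.I
        + (τ * latticeSymbol h ξ : ℝ)) * latticeSymbol h ξ))
      (bound := fun ξ => ‖g ξ‖ * (Real.exp (4 / h ^ 2) * (4 / h ^ 2))) (μ := volume)
      -- Slightly negative times are allowed so that `t = 0` is interior; since `τ > -1`, the
      -- exponential is at most `exp (4 / h²)`.
      (Ioi_mem_nhds (show (-1 : ℝ) < t by linarith))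
      (Eventually.of_forall fun τ => aestronglyMeasurable_latticeWave_integrand hg h τ _)
      (integrable_latticeWave_integrand hg h _ ht)
      (hg.aestronglyMeasurable.mul (by fun_prop : Continuous _).aestronglyMeasurable)
      (Eventually.of_forall fun ξ τ hτ => ?_) (hg.norm.mul_const _)
      (Eventually.of_forall fun ξ τ hτ => ?_)).2
    · refine (hderiv.congr_deriv ?_).hasDerivWithinAt
      simp only [latticeWave]
      have hI := fun j : ℤ => integrable_latticeWave_integrand hg h (j * h) ht
      rw [← integral_sub_two_mul_add (hI _) (hI _) (hI _), ← integral_div]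
      refine integral_congr_ae (Eventually.of_forall fun ξ => ?_)
      simp only [Complex.exp_add]
      have := discreteLaplacian_exp h ξ k
      linear_combination (-(g ξ * Complex.exp (t * latticeSymbol h ξ : ℝ))) * this
    · rw [← mul_assoc, norm_mul, norm_latticeWave_integrand, mul_assoc, Complex.norm_real]
      have h1 : Real.exp (τ * latticeSymbol h ξ) ≤ Real.exp (4 / h ^ 2) := by
        have h2 := abs_latticeSymbol_le h ξ
        rw [abs_of_nonpos (latticeSymbol_nonpos h ξ)] at h2
        have h3 := mul_nonneg (neg_nonneg.2 (latticeSymbol_nonpos h ξ))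
          (by linarith [mem_Ioi.1 hτ] : 0 ≤ τ + 1)
        gcongr
        linarith
      gcongr
      exact abs_latticeSymbol_le h ξ
    · have h1 : HasDerivAt (fun τ : ℝ => ((2 * Real.pi * ξ * (k * h) : ℝ) * Complex.I +
          (τ * latticeSymbol h ξ : ℝ) : ℂ)) (latticeSymbol h ξ : ℂ) τ := by
        refine HasDerivAt.const_add _ ?_
        simpa using ((hasDerivAt_id τ).mul_const (latticeSymbol h ξ)).ofReal_comp
      exact h1.cexp.const_mul (g ξ)

theorem tendsto_latticeWave_one {g : ℝ → ℂ} (hg : Integrable g) (x : ℝ) :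
    Tendsto (fun h => latticeWave g h 1 x) (𝓝[>] 0) (𝓝 (heatExtension g x)) := by
  refine tendsto_integral_filter_of_dominated_convergence (fun ξ => ‖g ξ‖)
    (Eventually.of_forall fun h => aestronglyMeasurable_latticeWave_integrand hg h 1 x)
    (Eventually.of_forall fun h => Eventually.of_forall fun ξ =>
      norm_latticeWave_integrand_le g h x ξ zero_le_one) hg.norm
    (Eventually.of_forall fun ξ => ?_)
  refine Tendsto.const_mul _ ((Complex.continuous_exp.tendsto _).comp ?_)
  have h1 : Tendsto (fun h => ((1 * latticeSymbol h ξ : ℝ) : ℂ)) (𝓝[>] 0)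
      (𝓝 ((-(2 * Real.pi * ξ) ^ 2 : ℝ) : ℂ)) := by
    simp only [one_mul]
    exact (Complex.continuous_ofReal.tendsto _).comp (tendsto_latticeSymbol ξ)
  convert h1.const_add ((2 * Real.pi * ξ * x : ℝ) * Complex.I : ℂ) using 2
  push_cast
  ring

theorem norm_heatExtension_integrand (g : ℝ → ℂ) (z : ℂ) (ξ : ℝ) :
    ‖g ξ * Complex.exp ((2 * Real.pi * ξ : ℝ) * z * Complex.I - ((2 * Real.pi * ξ) ^ 2 : ℝ))‖ =
      ‖g ξ‖ * Real.exp (-(2 * Real.pi * ξ * z.im) - (2 * Real.pi * ξ) ^ 2) := by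
  rw [norm_mul, Complex.norm_exp, Complex.sub_re, Complex.ofReal_re, mul_assoc,
    Complex.re_ofReal_mul, Complex.mul_I_re, mul_neg]

/-- Completing the square in `2 π ξ` produces the constant `1 / 4` that sets the threshold in
Hardy's principle. -/
theorem norm_heatExtension_integrand_le (g : ℝ → ℂ) (z : ℂ) (ξ : ℝ) :
    ‖g ξ * Complex.exp ((2 * Real.pi * ξ : ℝ) * z * Complex.I - ((2 * Real.pi * ξ) ^ 2 : ℝ))‖ ≤
      ‖g ξ‖ * Real.exp (z.im ^ 2 / 4) := by
  rw [norm_heatExtension_integrand]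
  gcongr
  nlinarith [sq_nonneg (2 * Real.pi * ξ + z.im / 2)]

theorem aestronglyMeasurable_heatExtension_integrand {g : ℝ → ℂ} (hg : Integrable g) (z : ℂ) :
    AEStronglyMeasurable (fun ξ : ℝ => g ξ *
      Complex.exp ((2 * Real.pi * ξ : ℝ) * z * Complex.I - ((2 * Real.pi * ξ) ^ 2 : ℝ))) :=
  hg.aestronglyMeasurable.mul (by fun_prop : Continuous _).aestronglyMeasurable

theorem integrable_heatExtension_integrand {g : ℝ → ℂ} (hg : Integrable g) (z : ℂ) :
    Integrable (fun ξ : ℝ => g ξ *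
      Complex.exp ((2 * Real.pi * ξ : ℝ) * z * Complex.I - ((2 * Real.pi * ξ) ^ 2 : ℝ))) :=
  (hg.norm.mul_const _).mono' (aestronglyMeasurable_heatExtension_integrand hg z)
    (Eventually.of_forall (norm_heatExtension_integrand_le g z))

theorem norm_heatExtension_le {g : ℝ → ℂ} (hg : Integrable g) (z : ℂ) :
    ‖heatExtension g z‖ ≤ (∫ ξ, ‖g ξ‖) * Real.exp (z.im ^ 2 / 4) := by
  rw [← integral_mul_const]
  exact norm_integral_le_of_norm_le (hg.norm.mul_const _)
    (Eventually.of_forall (norm_heatExtension_integrand_le g z))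

theorem differentiable_heatExtension {g : ℝ → ℂ} (hg : Integrable g) :
    Differentiable ℂ (heatExtension g) := fun z => by
  refine (hasDerivAt_integral_of_dominated_loc_of_deriv_le
    (F := fun (w : ℂ) (ξ : ℝ) => g ξ *
      Complex.exp ((2 * Real.pi * ξ : ℝ) * w * Complex.I - ((2 * Real.pi * ξ) ^ 2 : ℝ)))
    (F' := fun (w : ℂ) (ξ : ℝ) => g ξ *
      (Complex.exp ((2 * Real.pi * ξ : ℝ) * w * Complex.I - ((2 * Real.pi * ξ) ^ 2 : ℝ)) *
        ((2 * Real.pi * ξ : ℝ) * Complex.I)))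
    -- With `η = 2 π ξ`, the derivative's factor `|η|` is absorbed in `exp |η|`. On the unit ball
    -- the exponent is then at most `|η| (|Im z| + 2) - η²`; complete the square.
    (bound := fun ξ => ‖g ξ‖ * Real.exp ((|z.im| + 2) ^ 2 / 4)) (μ := volume)
    (Metric.ball_mem_nhds z one_pos)
    (Eventually.of_forall fun w => aestronglyMeasurable_heatExtension_integrand hg w)
    (integrable_heatExtension_integrand hg z)
    (hg.aestronglyMeasurable.mul (by fun_prop : Continuous _).aestronglyMeasurable)
    (Eventually.of_forall fun ξ w hw => ?_) (hg.norm.mul_const _)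
    (Eventually.of_forall fun ξ w hw => ?_)).2.differentiableAt
  · rw [← mul_assoc, norm_mul, norm_heatExtension_integrand, mul_assoc, norm_mul,
      Complex.norm_real, Complex.norm_I, mul_one, Real.norm_eq_abs]
    set η := 2 * Real.pi * ξ
    have him : |w.im| ≤ |z.im| + 1 := by
      have h1 := (Complex.abs_im_le_norm (w - z)).trans (mem_ball_iff_norm.1 hw).le
      rw [Complex.sub_im] at h1
      linarith [abs_sub_abs_le_abs_sub w.im z.im]
    have hη : |η| ≤ Real.exp |η| := by linarith [Real.add_one_le_exp |η|]
    have hprod : -(η * w.im) ≤ |η| * (|z.im| + 1) := by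
      calc _ ≤ |η * w.im| := neg_le_abs _
        _ = |η| * |w.im| := abs_mul _ _
        _ ≤ _ := by gcongr
    gcongr
    calc _ ≤ Real.exp (-(η * w.im) - η ^ 2) * Real.exp |η| := by gcongr
      _ = Real.exp (-(η * w.im) - η ^ 2 + |η|) := (Real.exp_add _ _).symm
      _ ≤ _ := by
        gcongr
        nlinarith [sq_nonneg (|η| - (|z.im| + 2) / 2), sq_abs η]
  · have h1 : HasDerivAt (fun w : ℂ => (2 * Real.pi * ξ : ℝ) * w * Complex.I -
        ((2 * Real.pi * ξ) ^ 2 : ℝ)) ((2 * Real.pi * ξ : ℝ) * Complex.I) w := by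
      simpa using (((hasDerivAt_id w).const_mul ((2 * Real.pi * ξ : ℝ) : ℂ)).mul_const
        Complex.I).sub_const (((2 * Real.pi * ξ) ^ 2 : ℝ) : ℂ)
    exact h1.cexp.const_mul (g ξ)

/-- On the real axis `heatExtension g` is the inverse Fourier transform of `g` times a nowhere
vanishing Gaussian. -/
theorem ae_eq_zero_of_heatExtension_eq_zero {g : ℝ → ℂ} (hg : Integrable g)
    (h : ∀ x : ℝ, heatExtension g x = 0) : g =ᵐ[volume] 0 := by
  have hfac := fun ξ x : ℝ => (by
    rw [mul_assoc, ← Complex.exp_add]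
    congr 2
    push_cast
    ring : g ξ * Complex.exp (-((2 * Real.pi * ξ) ^ 2 : ℝ) : ℂ) *
      Complex.exp ((2 * Real.pi * ξ * x : ℝ) * Complex.I) =
      g ξ * Complex.exp ((2 * Real.pi * ξ : ℝ) * (x : ℂ) * Complex.I -
        ((2 * Real.pi * ξ) ^ 2 : ℝ)))
  have hint : Integrable fun ξ : ℝ => g ξ * Complex.exp (-((2 * Real.pi * ξ) ^ 2 : ℝ) : ℂ) := by
    simpa using integrable_heatExtension_integrand hg 0
  have hae := ae_eq_zero_of_fourierInv_eq_zero hint fun x => by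
    rw [fourierInv_eq_integral_mul_exp]
    simp_rw [hfac]
    exact h x
  filter_upwards [hae] with ξ hξ
  exact (mul_eq_zero.1 hξ).resolve_right (Complex.exp_ne_zero _)

/-! ### Passage to the limit and conclusion -/

/-- The Bessel ratio bound, as a bound by exponentials that is also valid for nonpositive
arguments. -/
theorem exists_exp_bound_of_besselI_bound {w : ℝ → ℤ → ℂ} {α C : ℝ} (hα : α < 2)
    (hw : ∀ h : ℝ, 0 < h → ∀ k : ℤ,
      ‖w h k‖ ≤ C * (besselI k (α / h ^ 2) / besselI 0 (α / h ^ 2))) :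
    ∃ a : ℝ, 0 < a ∧ a < 2 ∧ ∀ h : ℝ, 0 < h → ∀ (k : ℤ) (l : ℝ),
      ‖w h k‖ ≤ C * Real.exp (-(k * l) + a / h ^ 2 * (Real.cosh l - 1)) := by
  have hC : 0 ≤ C := by
    have h0 := (norm_nonneg _).trans (hw 1 one_pos 0)
    rwa [div_self (besselI_zero_pos _).ne', mul_one] at h0
  -- Raising `α` to at least 1 only weakens the bound, keeps it below 2, and makes division by `a`
  -- legitimate.
  refine ⟨max α 1, by positivity, max_lt hα one_lt_two, fun h hh k l => ?_⟩
  have hcosh : 0 ≤ Real.cosh l - 1 := sub_nonneg.2 (Real.one_le_cosh l)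
  rcases lt_or_ge α 0 with hneg | hpos
  · have hα' : α / h ^ 2 < 0 := div_neg_of_neg_of_pos hneg (by positivity)
    have h1 := (norm_nonneg _).trans (hw h hh 1)
    have h2 := div_neg_of_neg_of_pos (besselI_one_neg hα') (besselI_zero_pos (α / h ^ 2))
    have hC0 : C = 0 := le_antisymm (nonpos_of_mul_nonneg_left h1 h2) hC
    simpa [hC0] using hw h hh k
  · refine (hw h hh k).trans ?_
    gcongr
    refine (besselI_div_besselI_zero_le k (by positivity) l).trans ?_
    gcongr
    exact le_max_left _ _

theorem tendsto_cosh_sub_one_div_sq (c : ℝ) :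
    Tendsto (fun h : ℝ => (Real.cosh (c * h) - 1) / h ^ 2) (𝓝[>] 0) (𝓝 (c ^ 2 / 2)) := by
  have hd : HasDerivAt (fun h : ℝ => Real.sinh (c / 2 * h)) (c / 2) 0 := by
    simpa using ((hasDerivAt_id (0 : ℝ)).const_mul (c / 2)).sinh
  have h1 := hd.tendsto_slope_zero_right
  simp only [zero_add, mul_zero, Real.sinh_zero, sub_zero, smul_eq_mul] at h1
  convert! (h1.pow 2).const_mul 2 using 1
  · funext h
    rw [show c * h = 2 * (c / 2 * h) by ring, Real.cosh_two_mul, Real.cosh_sq]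
    ring
  · ring_nf

/-- The meshes `|x| / (n + 1)` tend to zero and contain `x`. Frequent validity suffices to compare
two limits that both exist. -/
theorem frequently_exists_int_mul_eq (x : ℝ) : ∃ᶠ h : ℝ in 𝓝[>] 0, ∃ k : ℤ, (k : ℝ) * h = x := by
  rcases eq_or_ne x 0 with rfl | hx
  · exact Eventually.frequently (Eventually.of_forall fun h => ⟨0, by simp⟩)
  obtain ⟨y, hy⟩ : ∃ y, y = |x| := ⟨_, rfl⟩
  have hpos : 0 < y := hy ▸ abs_pos.2 hx
  have hlim : Tendsto (fun n : ℕ => y / ((n : ℝ) + 1)) atTop (𝓝[>] 0) := by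
    refine tendsto_nhdsWithin_iff.2 ⟨?_, Eventually.of_forall fun n => ?_⟩
    · simpa only [mul_one_div, mul_zero] using
        (tendsto_one_div_add_atTop_nhds_zero_nat (𝕜 := ℝ)).const_mul y
    · exact mem_Ioi.2 (by positivity)
  refine hlim.frequently (Eventually.frequently (Eventually.of_forall fun n => ?_))
  have hn : (n : ℝ) + 1 ≠ 0 := by positivity
  rcases abs_choice x with h | h
  · refine ⟨n + 1, ?_⟩
    rw [hy, h]
    push_cast
    field_simp
  · refine ⟨-(n + 1), ?_⟩
    rw [hy, h]
    push_cast
    field_simp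

theorem tendsto_rpow_nhdsGT_zero {μ : ℝ} (hμ : 0 < μ) :
    Tendsto (fun h : ℝ => h ^ μ) (𝓝[>] 0) (𝓝 0) := by
  have := (Real.continuousAt_rpow_const 0 μ (Or.inr hμ.le)).tendsto
  rw [Real.zero_rpow hμ.ne'] at this
  exact this.mono_left nhdsWithin_le_nhds

theorem norm_sub_le_of_iSup_lt {w : ℤ → ℂ} {r : ℝ} (hr : 0 ≤ r)
    (hw : (⨆ k : ℤ, ENNReal.ofReal ‖w k‖) < ENNReal.ofReal r) (k : ℤ) : ‖w k‖ ≤ r :=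
  (ENNReal.ofReal_le_ofReal_iff hr).1 ((le_iSup (fun k => ENNReal.ofReal ‖w k‖) k).trans hw.le)

/-- Exponential decay of the discrete solutions at time one passes to the limit as Gaussian decay
of the solution of the heat equation. -/
theorem norm_heatExtension_le_gaussian {v : ℝ → ℝ → ℤ → ℂ} {g : ℝ → ℂ} (hg : Integrable g)
    {μ a C : ℝ} (hμ : 0 < μ) (ha : 0 < a)
    (hv : ∀ h : ℝ, 0 < h → IsDiscreteHeatSolution h (v h))
    (hmesh : ∀ h : ℝ, 0 < h → ∀ k : ℤ,
      ‖v h 0 k - FourierTransform.fourierInv g (k * h)‖ ≤ h ^ μ)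
    (hdecay : ∀ h : ℝ, 0 < h → ∀ (k : ℤ) (l : ℝ),
      ‖v h 1 k‖ ≤ C * Real.exp (-(k * l) + a / h ^ 2 * (Real.cosh l - 1))) (x : ℝ) :
    ‖heatExtension g x‖ ≤ C * Real.exp (-(1 / (2 * a) * x ^ 2)) := by
  -- The choice `l = x h / a` minimises `-(x / h) l + (a / h²) l² / 2`, the small-`l` form of the
  -- exponent when `k h = x`.
  have hlim : Tendsto (fun h : ℝ => C * Real.exp (-(x ^ 2 / a) +
      a * ((Real.cosh (x / a * h) - 1) / h ^ 2)) + h ^ μ) (𝓝[>] 0)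
      (𝓝 (C * Real.exp (-(x ^ 2 / a) + a * ((x / a) ^ 2 / 2)) + 0)) :=
    ((((Real.continuous_exp.tendsto _).comp
      (((tendsto_cosh_sub_one_div_sq (x / a)).const_mul a).const_add _)).const_mul C).add
      (tendsto_rpow_nhdsGT_zero hμ))
  have hexp : -(x ^ 2 / a) + a * ((x / a) ^ 2 / 2) = -(1 / (2 * a) * x ^ 2) := by
    field_simp
    ring
  rw [hexp, add_zero] at hlim
  refine le_of_tendsto_of_tendsto_of_frequently (tendsto_latticeWave_one hg x).norm hlim ?_
  refine ((frequently_exists_int_mul_eq x).and_eventually self_mem_nhdsWithin).mono ?_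
  rintro h ⟨⟨k, rfl⟩, hh : 0 < h⟩
  have h1 := ((hv h hh).sub (isDiscreteHeatSolution_latticeWave hg h)).norm_le
    (M₀ := h ^ μ) (fun j => by simpa only [latticeWave_zero] using hmesh h hh j) zero_le_one k
  have h2 := hdecay h hh k (k * h / a * h)
  rw [show -((k : ℝ) * (k * h / a * h)) = -((k * h) ^ 2 / a) by ring,
    show a / h ^ 2 * (Real.cosh (k * h / a * h) - 1) =
      a * ((Real.cosh (k * h / a * h) - 1) / h ^ 2) by ring] at h2
  calc ‖latticeWave g h 1 (k * h)‖
      = ‖v h 1 k - (v h 1 k - latticeWave g h 1 (k * h))‖ := by rw [sub_sub_cancel]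
    _ ≤ ‖v h 1 k‖ + ‖v h 1 k - latticeWave g h 1 (k * h)‖ := norm_sub_le _ _
    _ ≤ _ := add_le_add h2 h1

theorem theorem3p2
    (v : ℝ → ℝ → ℤ → ℂ) (u₀ : ℝ → ℂ) (s μ α C : ℝ)
    (hv : ∀ h : ℝ, 0 < h → IsDiscreteHeatSolution h (v h))
    (hs : 1 / 2 < s) (hu₀ : IsContinuousSobolev s u₀)
    (hμ : 0 < μ)
    (hmesh : ∀ h : ℝ, 0 < h →
      (⨆ k : ℤ, ENNReal.ofReal ‖v h 0 k - u₀ (k * h)‖) < ENNReal.ofReal (h ^ μ))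
    (hα : α < 2)
    (hdecay : ∀ h : ℝ, 0 < h → ∀ k : ℤ,
      ‖v h 1 k‖ ≤ C * (besselI k (α / h ^ 2) / besselI 0 (α / h ^ 2))) :
    (∀ x : ℝ, u₀ x = 0) ∧
    TendstoUniformlyOn (fun (h : ℝ) (p : ℝ × ℤ) => v h p.1 p.2) (fun _ => 0) (𝓝[>] 0)
      (Ici 0 ×ˢ univ) := by
  have hmesh' : ∀ h : ℝ, 0 < h → ∀ k : ℤ, ‖v h 0 k - u₀ (k * h)‖ ≤ h ^ μ := fun h hh =>
    norm_sub_le_of_iSup_lt (Real.rpow_nonneg hh.le μ) (hmesh h hh)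
  have hzero : ∀ x : ℝ, u₀ x = 0 := by
    obtain ⟨g, hg, hug⟩ := hu₀.exists_fourierInv_eq hs
    obtain ⟨a, ha0, ha2, ha⟩ := exists_exp_bound_of_besselI_bound (w := fun h k => v h 1 k)
      hα hdecay
    have ha4 : 1 / 4 < 1 / (2 * a) := one_div_lt_one_div_of_lt (by positivity) (by linarith)
    have hext := eq_zero_of_gaussian_bounds (differentiable_heatExtension hg) ha4
      (norm_heatExtension_le hg) (norm_heatExtension_le_gaussian hg hμ ha0 hv
        (fun h hh k => by simpa only [hug] using hmesh' h hh k) ha)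
    have hg0 := ae_eq_zero_of_heatExtension_eq_zero hg fun x => hext x
    intro x
    rw [hug, fourierInv_eq_integral_mul_exp]
    refine integral_eq_zero_of_ae ?_
    filter_upwards [hg0] with ξ hξ
    simp [hξ]
  refine ⟨hzero, Metric.tendstoUniformlyOn_iff.2 fun ε hε => ?_⟩
  filter_upwards [(tendsto_rpow_nhdsGT_zero hμ).eventually_lt_const hε, self_mem_nhdsWithin]
    with h hlt hh p hp
  rw [dist_zero_left]
  exact ((hv h hh).norm_le (fun k => by simpa [hzero] using hmesh' h hh k) hp.1 p.2).trans_lt hlt
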